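/- Consider a CSMA network with energy harvesting. Packets of duration $L>0$ arrive in the plane according to a space-time Poisson process with intensity $\lambda/L$ per unit area and unit time ($\lambda>0$), each packet having its own transmitter. A typical transmitter is at distance $d>0$ from its receiver; fading is independent Rayleigh, the path-loss exponent is $\alpha>2$, noise is neglected, and all transmitters use unit power. The typical transmitter backs off at time $0$ unless its signal-to-interference ratio $\mathsf{SIR}$ exceeds the threshold $\theta>0$; the interference comes from the other packets that arrived in $(-L,0]$ and whose transmitters were not in back-off and had energy. Back-offs are assumed independent: each other transmitter is in back-off with probability $P_b$ and has energy with probability $r$, where these indicators, the fading coefficients and the packet arrivals are all independent. Here $r=\lim_{t\to\infty}P(E(t)\ge 1)$ for the energy queue with infinite battery on $\{0,1,2,\dots\}$ that gains one unit with probability $p\in(0,1]$ in each slot and, when $E(t)\ge 1$, spends one unit with probability $1-P_b$, independently. The back-off probability $P_b$ is self-consistent: $P_b=P(\mathsf{SIR}\le\theta)$. Put $$\kappa(\alpha)=\frac{2\pi^2}{\alpha\sin(2\pi/\alpha)},\qquad \lambda_{\max}=\frac{1}{d^2\,\theta^{2/\alpha}\,\kappa(\alpha)} .$$ Then: 1.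 If $\dfrac{-\lambda_{\max}\ln p}{\lambda}>p$, then $P_b=1-\exp\left(-\dfrac{p\,\lambda}{\lambda_{\max}}\right)$. 2. Otherwise $P_b$ satisfies $P_b=1-\exp\left(-\dfrac{\lambda(1-P_b)}{\lambda_{\max}}\right)$, and the only real solution of this equation is $P_b=1-\dfrac{\lambda_{\max}}{\lambda}\,W_0\!\left(\dfrac{\lambda}{\lambda_{\max}}\right)$, where $W_0$ is the principal real branch of Lambert's function. -/

import Mathlib

open MeasureTheory ProbabilityTheory Filter Topology

noncomputable section

namespace EnergyCSMA

/-! ### Poisson point processes -/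

/-- The number of indices `m` with `X m ω ∈ B`: the counting measure of the random points
`X 0, X 1, …` evaluated at `B`. -/
def pointCount {Ω S : Type*} [MeasurableSpace S] (X : ℕ → Ω → S) (B : Set S) (ω : Ω) : ENNReal :=
  Measure.sum (fun m => Measure.dirac (X m ω)) B

/-- The random points `X 0, X 1, …` form a Poisson point process with intensity measure `Λ`:
the number of points in a set `B` of finite intensity is Poisson distributed with mean `Λ B`, and
the numbers of points in finitely many pairwise disjoint such sets are independent. -/
structure IsPoissonPointProcess {Ω S : Type*} [MeasurableSpace Ω] [MeasurableSpace S]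
    (X : ℕ → Ω → S) (Λ : Measure S) (P : Measure Ω) : Prop where
  measurable : ∀ m, Measurable (X m)
  count_law : ∀ B : Set S, MeasurableSet B → Λ B ≠ ⊤ →
    HasLaw (pointCount X B) ((poissonMeasure (Λ B).toNNReal).map (Nat.cast : ℕ → ENNReal)) P
  indep_count : ∀ (n : ℕ) (B : Fin n → Set S), (∀ i, MeasurableSet (B i)) → (∀ i, Λ (B i) ≠ ⊤) →
    Pairwise (fun i j => Disjoint (B i) (B j)) → iIndepFun (fun i => pointCount X (B i)) P

/-! ### Energy queue with an infinite battery -/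

/-- Transition probabilities of the energy level: in each slot one unit of energy arrives with
probability `p`, and, if the level is at least `1`, one unit is spent with probability `q`. -/
def energyStep (p q : ℝ) (i j : ℕ) : ℝ :=
  if i = 0 then
    if j = 1 then p else if j = 0 then 1 - p else 0
  else
    if j = i + 1 then p * (1 - q)
    else if j + 1 = i then q * (1 - p)
    else if j = i then p * q + (1 - p) * (1 - q)
    else 0

/-- `energyLaw p q e₀ t k` is the probability that the energy level at time `t` is `k`, when the
battery starts at level `e₀`. -/
def energyLaw (p q : ℝ) (e₀ : ℕ) : ℕ → ℕ → ℝ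
  | 0, k => if k = e₀ then 1 else 0
  | t + 1, k => ∑' i, energyLaw p q e₀ t i * energyStep p q i k

/-- `r` is the steady-state probability that the energy level is at least `1`. -/
def IsEnergyAvailability (p q : ℝ) (e₀ : ℕ) (r : ℝ) : Prop :=
  Tendsto (fun t => ∑' k, energyLaw p q e₀ t (k + 1)) atTop (𝓝 r)

/-! ### Fading -/

/-- The Rayleigh distribution with scale `s`. -/
def rayleigh (s : ℝ) : Measure ℝ :=
  volume.withDensity fun x =>
    ENNReal.ofReal (if 0 ≤ x then x / s ^ 2 * Real.exp (-x ^ 2 / (2 * s ^ 2)) else 0)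

/-! ### The CSMA network -/

/-- The Euclidean plane. -/
abbrev Plane := EuclideanSpace ℝ (Fin 2)

/-- A CSMA network seen from a typical transmitter-receiver pair at time `0`. The other packets are
numbered by `ℕ`; each has its own transmitter. -/
structure Network (Ω : Type*) where
  /-- location of the typical transmitter -/
  tx : Plane
  /-- location of the typical receiver -/
  rx : Plane
  /-- transmitter location and arrival time of packet `m` -/
  packet : ℕ → Ω → Plane × ℝ
  /-- the transmitter of packet `m` is not in back-off -/
  clear : ℕ → Ω → Bool
  /-- the transmitter of packet `m` has at least one unit of energy -/
  charged : ℕ → Ω → Bool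
  /-- modulus of the fading coefficient from the transmitter of packet `m` to the typical
  receiver -/
  fade : ℕ → Ω → ℝ
  /-- modulus of the fading coefficient between the typical transmitter and its receiver -/
  fade₀ : Ω → ℝ

namespace Network

variable {Ω : Type*} (N : Network Ω)

open Classical in
/-- Power received at the typical receiver, at time `0`, from packet `m`: a packet of duration `L`
is on air at time `0` if it arrived in `(-L, 0]`, its transmitter was not in back-off and it had
energy. -/
def receivedPower (L α : ℝ) (m : ℕ) (ω : Ω) : ENNReal :=
  if (N.packet m ω).2 ∈ Set.Ioc (-L) 0 ∧ N.clear m ω = true ∧ N.charged m ω = true then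
    ENNReal.ofReal (dist N.rx (N.packet m ω).1 ^ (-α) * N.fade m ω ^ 2)
  else 0

/-- Signal-to-interference ratio of the typical pair at time `0`, in `[0, ∞]`; it is `∞` if there
is signal and no interference. -/
def SIR (L α : ℝ) (ω : Ω) : ENNReal :=
  ENNReal.ofReal (dist N.tx N.rx ^ (-α) * N.fade₀ ω ^ 2) / ∑' m, N.receivedPower L α m ω

/-- The typical transmitter backs off: the channel is not sensed idle, i.e. `SIR > θ` fails. -/
def backoffEvent (L α θ : ℝ) : Set Ω :=
  {ω | ¬ ENNReal.ofReal θ < N.SIR L α ω}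

/-- The laws of the model with independent back-offs, when every other transmitter is in back-off
with probability `b` and has energy with probability `r`. Packets arrive at rate `lam / L` per unit
area and unit time; back-off indicators, energy indicators and Rayleigh fading coefficients are
independent of each other, across transmitters, and of the packet arrivals. -/
structure HasIndependentBackoffs [MeasurableSpace Ω] (P : Measure Ω) (lam L d s : ℝ)
    (b r : unitInterval) : Prop where
  dist_pair : dist N.tx N.rx = d
  packets : IsPoissonPointProcess N.packet (ENNReal.ofReal (lam / L) • volume) P
  measurable_clear : ∀ m, Measurable (N.clear m)
  measurable_charged : ∀ m, Measurable (N.charged m)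
  measurable_fade : ∀ m, Measurable (N.fade m)
  measurable_fade₀ : Measurable N.fade₀
  /-- back-off, energy and fading of one transmitter are independent, with the stated laws -/
  mark_law : ∀ m, HasLaw (fun ω => (N.clear m ω, N.charged m ω, N.fade m ω))
    ((bernoulliMeasure true false (unitInterval.symm b)).prod
      ((bernoulliMeasure true false r).prod (rayleigh s))) P
  fade₀_law : HasLaw N.fade₀ (rayleigh s) P
  /-- independence across transmitters -/
  indep_marks : iIndepFun (fun m ω => (N.clear m ω, N.charged m ω, N.fade m ω)) P
  /-- independence of arrivals and marks -/
  indep_packets : IndepFun (fun ω m => N.packet m ω)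
    (fun ω m => (N.clear m ω, N.charged m ω, N.fade m ω)) P
  /-- independence of the typical link from everything else -/
  indep_fade₀ : IndepFun N.fade₀
    (fun ω => ((fun m => N.packet m ω),
      fun m => (N.clear m ω, N.charged m ω, N.fade m ω))) P

/-- `b` is the back-off probability of the CSMA network with energy arrival rate `p` and infinite
batteries: under independent back-offs, when every other transmitter is in back-off with
probability `b` and has energy with the steady-state probability of an energy queue whose access
probability is `1 - b`, the typical transmitter is in back-off with the same probability `b`. -/
def IsBackoffProbability [MeasurableSpace Ω] (P : Measure Ω) (lam L d s α θ p : ℝ) (e₀ : ℕ)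
    (b : unitInterval) : Prop :=
  ∃ r : unitInterval, IsEnergyAvailability p (1 - b) e₀ r ∧
    N.HasIndependentBackoffs P lam L d s b r ∧
    P.real (N.backoffEvent L α θ) = b

end Network

/-! ### Constants -/

/-- `κ(α) = 2π² / (α sin(2π/α))`. -/
def kappa (α : ℝ) : ℝ := 2 * Real.pi ^ 2 / (α * Real.sin (2 * Real.pi / α))

/-- `λ_max = 1 / (d² θ^(2/α) κ(α))`. -/
def lamMax (d θ α : ℝ) : ℝ := 1 / (d ^ 2 * θ ^ (2 / α) * kappa α)

/-- The principal real branch `W₀` of Lambert's function: for `y ≥ -1/e`, the unique `w ≥ -1` with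
`w * exp w = y`. -/
def lambertW₀ (y : ℝ) : ℝ := Function.invFunOn (fun w : ℝ => w * Real.exp w) (Set.Ici (-1)) y

end EnergyCSMA

end

namespace EnergyCSMA

open scoped ENNReal

/-! ### The energy queue -/

/-! Everything reduces to one scalar fixed-point equation. Write `q = 1 - b` for the access
probability and `M` for `lamMax d θ α`.

Energy: in the limit, units are spent at rate `q * r`, and this rate equals `min p q`
(`IsEnergyAvailability.mul_eq_min`). No stationary law or recurrence criterion is needed. The drift
of the mean level gives `q * r ≤ p`, and the drift of the generating function at `z`, followed by `z
→ 1`, gives the opposite bound.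

Radio: with Rayleigh fading, the success probability given interference `I` is `exp (-c I)`, so the
unconditional one is the Laplace functional of a marked Poisson process
(`IsPoissonPointProcess.lintegral_expNeg_marked`). Averaging over the marks of a packet leaves a
planar integral, computed in polar coordinates and by the reflection formula for Gamma; it produces
`kappa α` (`lintegral_plane_one_sub`). The success probability is therefore `exp (-lam * (q * r) /
M)`.

Together, `1 - b = exp (-lam * min p (1 - b) / M)`. Since `exp (-lam * x / M)` decreases in `x`,
comparing `p` with its value at `x = p` decides which argument attains the minimum. If it is `p`,
the equation is explicit; if it is `1 - b`, the substitution `w = lam * (1 - b) / M` turns it into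
`w * exp w = lam / M`, which is Lambert's equation. -/

theorem energyLaw_eq_zero_of_lt (p q : ℝ) (e₀ : ℕ) :
    ∀ t k : ℕ, e₀ + t < k → energyLaw p q e₀ t k = 0
  | 0, k, h => by
    rw [energyLaw, if_neg (by omega)]
  | t + 1, k, h => by
    rw [energyLaw]
    refine (tsum_congr fun i => ?_).trans tsum_zero
    rcases lt_or_ge (e₀ + t) i with hi | hi
    · rw [energyLaw_eq_zero_of_lt p q e₀ t i hi, zero_mul]
    · have : energyStep p q i k = 0 := by
        unfold energyStep
        split_ifs <;> first | rfl | omega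
      rw [this, mul_zero]

theorem energyStep_nonneg {p q : ℝ} (hp₀ : 0 ≤ p) (hp₁ : p ≤ 1) (hq₀ : 0 ≤ q) (hq₁ : q ≤ 1)
    (i j : ℕ) : 0 ≤ energyStep p q i j := by
  have := sub_nonneg.2 hp₁
  have := sub_nonneg.2 hq₁
  unfold energyStep
  split_ifs <;> positivity

theorem energyLaw_nonneg {p q : ℝ} (hp₀ : 0 ≤ p) (hp₁ : p ≤ 1) (hq₀ : 0 ≤ q) (hq₁ : q ≤ 1)
    (e₀ : ℕ) : ∀ t k : ℕ, 0 ≤ energyLaw p q e₀ t k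
  | 0, k => by rw [energyLaw]; split_ifs <;> norm_num
  | t + 1, k => by
    rw [energyLaw]
    exact tsum_nonneg fun i => mul_nonneg (energyLaw_nonneg hp₀ hp₁ hq₀ hq₁ e₀ t i)
      (energyStep_nonneg hp₀ hp₁ hq₀ hq₁ i k)

/-- Expectation of `f` of the energy level at time `t`. -/
noncomputable def energyMean (p q : ℝ) (e₀ t : ℕ) (f : ℕ → ℝ) : ℝ :=
  ∑ k ∈ Finset.range (e₀ + t + 1), energyLaw p q e₀ t k * f k

/-- Transition operator of the energy queue. -/
def energyOp (p q : ℝ) (f : ℕ → ℝ) : ℕ → ℝ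
  | 0 => p * f 1 + (1 - p) * f 0
  | i + 1 => p * (1 - q) * f (i + 2) + q * (1 - p) * f i
      + (p * q + (1 - p) * (1 - q)) * f (i + 1)

theorem sum_energyStep_mul (p q : ℝ) (f : ℕ → ℝ) (i n : ℕ) (h : i + 1 < n) :
    ∑ k ∈ Finset.range n, energyStep p q i k * f k = energyOp p q f i := by
  cases i with
  | zero =>
    have : ∀ k, energyStep p q 0 k * f k
        = (if k = 1 then p * f k else 0) + (if k = 0 then (1 - p) * f k else 0) := by
      intro k
      unfold energyStep
      split_ifs <;> first | omega | simp
    simp_rw [this, Finset.sum_add_distrib, Finset.sum_ite_eq', Finset.mem_range]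
    rw [if_pos (by omega), if_pos (by omega)]
    rfl
  | succ m =>
    have : ∀ k, energyStep p q (m + 1) k * f k
        = (if k = m + 2 then p * (1 - q) * f k else 0) + (if k = m then q * (1 - p) * f k else 0)
          + (if k = m + 1 then (p * q + (1 - p) * (1 - q)) * f k else 0) := by
      intro k
      unfold energyStep
      rw [if_neg (Nat.succ_ne_zero m)]
      simp only [Nat.add_right_cancel_iff, add_assoc, Nat.reduceAdd]
      split_ifs <;> first | omega | simp
    simp_rw [this, Finset.sum_add_distrib, Finset.sum_ite_eq', Finset.mem_range]
    rw [if_pos (by omega), if_pos (by omega), if_pos (by omega)]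
    rfl

/-- Duality between the law and the test function: one step of the chain can be moved onto `f`.
Every drift computation below then becomes a pointwise identity for `energyOp`. The sums are finite
because the level grows by at most one per slot. -/
theorem energyMean_succ (p q : ℝ) (e₀ t : ℕ) (f : ℕ → ℝ) :
    energyMean p q e₀ (t + 1) f = energyMean p q e₀ t (energyOp p q f) := by
  have h1 : ∀ k, energyLaw p q e₀ (t + 1) k
      = ∑ i ∈ Finset.range (e₀ + t + 1), energyLaw p q e₀ t i * energyStep p q i k := by
    intro k
    rw [energyLaw]
    refine tsum_eq_sum fun i hi => ?_
    rw [energyLaw_eq_zero_of_lt p q e₀ t i (by simpa using hi), zero_mul]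
  unfold energyMean
  simp_rw [h1, Finset.sum_mul]
  rw [Finset.sum_comm]
  refine Finset.sum_congr rfl fun i hi => ?_
  rw [← sum_energyStep_mul p q f i (e₀ + (t + 1) + 1)
    (by have := Finset.mem_range.1 hi; omega), Finset.mul_sum]
  exact Finset.sum_congr rfl fun k _ => mul_assoc _ _ _

theorem energyMean_add (p q : ℝ) (e₀ t : ℕ) (f g : ℕ → ℝ) :
    energyMean p q e₀ t (fun k => f k + g k)
      = energyMean p q e₀ t f + energyMean p q e₀ t g := by
  simp only [energyMean, mul_add, Finset.sum_add_distrib]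

theorem energyMean_const_mul (p q : ℝ) (e₀ t : ℕ) (c : ℝ) (f : ℕ → ℝ) :
    energyMean p q e₀ t (fun k => c * f k) = c * energyMean p q e₀ t f := by
  simp only [energyMean, Finset.mul_sum, mul_left_comm]

theorem energyMean_one (p q : ℝ) (e₀ : ℕ) : ∀ t, energyMean p q e₀ t (fun _ => 1) = 1
  | 0 => by simp [energyMean, energyLaw]
  | t + 1 => by
    rw [energyMean_succ]
    convert energyMean_one p q e₀ t using 2
    funext i
    cases i <;> simp only [energyOp] <;> ring

theorem energyMean_mono {p q : ℝ} (hp₀ : 0 ≤ p) (hp₁ : p ≤ 1) (hq₀ : 0 ≤ q) (hq₁ : q ≤ 1)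
    (e₀ t : ℕ) {f g : ℕ → ℝ} (h : ∀ k, f k ≤ g k) :
    energyMean p q e₀ t f ≤ energyMean p q e₀ t g :=
  Finset.sum_le_sum fun k _ =>
    mul_le_mul_of_nonneg_left (h k) (energyLaw_nonneg hp₀ hp₁ hq₀ hq₁ e₀ t k)

theorem energyMean_indicator_zero (p q : ℝ) (e₀ t : ℕ) :
    energyMean p q e₀ t (fun k => if k = 0 then 1 else 0) = energyLaw p q e₀ t 0 := by
  simp [energyMean]

theorem tsum_energyLaw_succ (p q : ℝ) (e₀ t : ℕ) :
    ∑' k, energyLaw p q e₀ t (k + 1) = 1 - energyLaw p q e₀ t 0 := by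
  have h1 := energyMean_one p q e₀ t
  simp only [energyMean, mul_one, Finset.sum_range_succ'] at h1
  rw [← h1, add_sub_cancel_right]
  exact tsum_eq_sum fun k hk => energyLaw_eq_zero_of_lt p q e₀ t _ (by
    have : e₀ + t ≤ k := by simpa using hk
    omega)

/-- A convergent sequence with partial sums bounded below has a nonnegative limit. -/
theorem nonneg_of_tendsto_of_sum_ge {u : ℕ → ℝ} {l C : ℝ} (hu : Tendsto u atTop (𝓝 l))
    (hC : ∀ n, C ≤ ∑ i ∈ Finset.range n, u i) : 0 ≤ l := by
  have h1 : Tendsto (fun n : ℕ => (n : ℝ)⁻¹ * C) atTop (𝓝 (0 * C)) :=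
    (tendsto_inv_atTop_nhds_zero_nat (𝕜 := ℝ)).mul_const C
  rw [zero_mul] at h1
  exact le_of_tendsto_of_tendsto' h1 hu.cesaro fun n =>
    mul_le_mul_of_nonneg_left (hC n) (by positivity)

section Steady

variable {p q r : ℝ} {e₀ : ℕ}

theorem IsEnergyAvailability.tendsto_zero (h : IsEnergyAvailability p q e₀ r) :
    Tendsto (fun t => energyLaw p q e₀ t 0) atTop (𝓝 (1 - r)) := by
  have h' : Tendsto _ _ _ := h
  simp_rw [tsum_energyLaw_succ] at h'
  simpa using h'.const_sub 1

theorem IsEnergyAvailability.le_one (hp₀ : 0 ≤ p) (hp₁ : p ≤ 1) (hq₀ : 0 ≤ q) (hq₁ : q ≤ 1)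
    (h : IsEnergyAvailability p q e₀ r) : r ≤ 1 :=
  sub_nonneg.1 (ge_of_tendsto' h.tendsto_zero fun t => energyLaw_nonneg hp₀ hp₁ hq₀ hq₁ e₀ t 0)

/-- Energy is not spent faster than it arrives. -/
theorem IsEnergyAvailability.mul_le (hp₀ : 0 ≤ p) (hp₁ : p ≤ 1) (hq₀ : 0 ≤ q) (hq₁ : q ≤ 1)
    (h : IsEnergyAvailability p q e₀ r) : q * r ≤ p := by
  have hstep : ∀ t, energyMean p q e₀ (t + 1) (fun k => (k : ℝ))
      - energyMean p q e₀ t (fun k => (k : ℝ)) = p - q + q * energyLaw p q e₀ t 0 := by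
    intro t
    -- The mean drift is `p - q`, except that nothing is spent at level `0`, which gives back `q`
    -- there.
    have hop : energyOp p q (fun k => (k : ℝ))
        = fun k : ℕ => (k : ℝ) + ((p - q) * 1 + q * (if k = 0 then 1 else 0)) := by
      funext k
      cases k with
      | zero => simp [energyOp]
      | succ k => simp only [energyOp]; push_cast; simp; ring
    rw [energyMean_succ, hop, energyMean_add, energyMean_add, energyMean_const_mul,
      energyMean_const_mul, energyMean_one, energyMean_indicator_zero]
    ring
  have hlim : Tendsto (fun t => p - q + q * energyLaw p q e₀ t 0) atTop
      (𝓝 (p - q + q * (1 - r))) := (h.tendsto_zero.const_mul q).const_add (p - q)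
  -- The drifts telescope to the change of the mean level since time `0`, which is at least minus
  -- the initial mean.
  have := nonneg_of_tendsto_of_sum_ge (C := - energyMean p q e₀ 0 (fun k => (k : ℝ))) hlim
    fun n => by
      simp_rw [← hstep]
      rw [Finset.sum_range_sub (fun t => energyMean p q e₀ t (fun k => (k : ℝ)))]
      have : 0 ≤ energyMean p q e₀ n (fun k => (k : ℝ)) :=
        Finset.sum_nonneg fun k _ =>
          mul_nonneg (energyLaw_nonneg hp₀ hp₁ hq₀ hq₁ e₀ n k) (by positivity)
      linarith
  linarith

/-- Drift of the generating function of the energy level at `z ∈ (0, 1)`. -/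
theorem IsEnergyAvailability.generating_bound (hp₀ : 0 ≤ p) (hp₁ : p ≤ 1) (hq₀ : 0 ≤ q)
    (hq₁ : q ≤ 1) (h : IsEnergyAvailability p q e₀ r) {z : ℝ} (hz₀ : 0 < z) (hz₁ : z < 1) :
    q * (1 - p + p * z) * (1 - r) ≤ max (q - p * z - p * q * (1 - z)) 0 := by
  -- At nonzero levels one step multiplies the expectation of `z ^ k` by `1 + (1 - z) / z * c`;
  -- level `0` needs a correction because nothing is spent there.
  set c := q - p * z - p * q * (1 - z) with hc
  set G : ℕ → ℝ := fun t => energyMean p q e₀ t (fun k => z ^ k) with hG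
  have hG0 : ∀ t, 0 ≤ G t := fun t => Finset.sum_nonneg fun k _ =>
    mul_nonneg (energyLaw_nonneg hp₀ hp₁ hq₀ hq₁ e₀ t k) (by positivity)
  have hG1 : ∀ t, G t ≤ 1 := fun t => by
    rw [← energyMean_one p q e₀ t]
    exact energyMean_mono hp₀ hp₁ hq₀ hq₁ e₀ t fun k => pow_le_one₀ hz₀.le hz₁.le
  have hz : 0 < 1 - z := sub_pos.2 hz₁
  have hstep : ∀ t, G (t + 1) - G t
      = (1 - z) / z * (c * G t - q * (1 - p + p * z) * energyLaw p q e₀ t 0) := by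
    intro t
    have hop : energyOp p q (fun k => z ^ k)
        = fun k => z ^ k + ((1 - z) / z * c * z ^ k
          + (-((1 - z) / z * (q * (1 - p + p * z)))) * (if k = 0 then 1 else 0)) := by
      funext k
      cases k with
      | zero => simp only [energyOp, hc]; simp; field_simp; ring
      | succ k => simp only [energyOp, hc]; simp; field_simp; ring
    simp only [hG]
    rw [energyMean_succ, hop, energyMean_add, energyMean_add, energyMean_const_mul,
      energyMean_const_mul, energyMean_indicator_zero]
    ring
  have hlim : Tendsto (fun t => max c 0 - q * (1 - p + p * z) * energyLaw p q e₀ t 0) atTop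
      (𝓝 (max c 0 - q * (1 - p + p * z) * (1 - r))) :=
    (h.tendsto_zero.const_mul _).const_sub _
  have key := nonneg_of_tendsto_of_sum_ge (C := -(z / (1 - z))) hlim fun n => by
    have h1 : ∀ t, z / (1 - z) * (G (t + 1) - G t)
        ≤ max c 0 - q * (1 - p + p * z) * energyLaw p q e₀ t 0 := by
      intro t
      have h2 : z / (1 - z) * (G (t + 1) - G t)
          = c * G t - q * (1 - p + p * z) * energyLaw p q e₀ t 0 := by
        rw [hstep]; field_simp
      rw [h2]
      -- Convergence of `G` is not known and `c` may have either sign, so only `0 ≤ G t ≤ 1` is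
      -- used; this is the source of the `max`.
      have h3 : c * G t ≤ max c 0 * 1 :=
        mul_le_mul (le_max_left _ _) (hG1 t) (hG0 t) (le_max_right _ _)
      linarith
    refine le_trans ?_ (Finset.sum_le_sum fun t _ => h1 t)
    rw [← Finset.mul_sum, Finset.sum_range_sub, ← mul_neg_one]
    refine mul_le_mul_of_nonneg_left ?_ (by positivity)
    linarith [hG0 n, hG1 0]
  linarith

/-- In the steady state, energy is spent at rate `min p q`. -/
theorem IsEnergyAvailability.mul_eq_min (hp₀ : 0 ≤ p) (hp₁ : p ≤ 1) (hq₀ : 0 ≤ q) (hq₁ : q ≤ 1)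
    (h : IsEnergyAvailability p q e₀ r) : q * r = min p q := by
  refine le_antisymm (le_min (h.mul_le hp₀ hp₁ hq₀ hq₁)
    (mul_le_of_le_one_right hq₀ (h.le_one hp₀ hp₁ hq₀ hq₁))) ?_
  -- Letting `z` increase to `1` turns the bound into `q * (1 - r) ≤ max (q - p) 0`, that is, `min p
  -- q ≤ q * r`.
  have hlim : q * (1 - p + p * 1) * (1 - r) ≤ max (q - p * 1 - p * q * (1 - 1)) 0 := by
    have hl : Tendsto (fun z : ℝ => q * (1 - p + p * z) * (1 - r)) (𝓝[<] 1)
        (𝓝 (q * (1 - p + p * 1) * (1 - r))) :=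
      Continuous.tendsto (f := fun z : ℝ => q * (1 - p + p * z) * (1 - r)) (by fun_prop) 1
        |>.mono_left nhdsWithin_le_nhds
    have hr : Tendsto (fun z : ℝ => max (q - p * z - p * q * (1 - z)) 0) (𝓝[<] 1)
        (𝓝 (max (q - p * 1 - p * q * (1 - 1)) 0)) :=
      Continuous.tendsto (f := fun z : ℝ => max (q - p * z - p * q * (1 - z)) 0) (by fun_prop) 1
        |>.mono_left nhdsWithin_le_nhds
    refine le_of_tendsto_of_tendsto hl hr ?_
    filter_upwards [Ioo_mem_nhdsLT (zero_lt_one (α := ℝ))] with z hz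
    exact h.generating_bound hp₀ hp₁ hq₀ hq₁ hz.1 hz.2
  rcases le_total p q with hpq | hpq
  · rw [max_eq_left (by linarith)] at hlim
    rw [min_eq_left hpq]; linarith
  · rw [max_eq_right (by linarith)] at hlim
    rw [min_eq_right hpq]; linarith

end Steady

/-! ### The function `exp (-x)` on `[0, ∞]` -/

/-- `exp (-x)` on `[0, ∞]`, with value `0` at `∞`. -/
noncomputable def expNeg (x : ℝ≥0∞) : ℝ≥0∞ := EReal.exp (-(x : EReal))

theorem continuous_expNeg : Continuous expNeg :=
  ENNReal.continuous_exp.comp (continuous_neg.comp continuous_coe_ennreal_ereal)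

theorem measurable_expNeg : Measurable expNeg := continuous_expNeg.measurable

theorem expNeg_antitone : Antitone expNeg := fun _ _ h =>
  EReal.exp_monotone (EReal.neg_le_neg_iff.2 (EReal.coe_ennreal_le_coe_ennreal_iff.2 h))

@[simp] theorem expNeg_zero : expNeg 0 = 1 := by simp [expNeg]

@[simp] theorem expNeg_top : expNeg ⊤ = 0 := by simp [expNeg]

theorem expNeg_le_one (x : ℝ≥0∞) : expNeg x ≤ 1 := by
  rw [← expNeg_zero]; exact expNeg_antitone zero_le

theorem expNeg_ne_top (x : ℝ≥0∞) : expNeg x ≠ ⊤ :=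
  ne_top_of_le_ne_top ENNReal.one_ne_top (expNeg_le_one x)

theorem expNeg_add (x y : ℝ≥0∞) : expNeg (x + y) = expNeg x * expNeg y := by
  rw [expNeg, EReal.coe_ennreal_add, EReal.neg_add (by simp) (by simp), sub_eq_add_neg,
    EReal.exp_add]
  rfl

theorem expNeg_ofReal {x : ℝ} (hx : 0 ≤ x) :
    expNeg (ENNReal.ofReal x) = ENNReal.ofReal (Real.exp (-x)) := by
  rw [expNeg, EReal.coe_ennreal_ofReal, max_eq_left hx, ← EReal.coe_neg, EReal.exp_coe]

theorem expNeg_sum {ι : Type*} (s : Finset ι) (f : ι → ℝ≥0∞) :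
    expNeg (∑ i ∈ s, f i) = ∏ i ∈ s, expNeg (f i) := by
  classical
  induction s using Finset.induction_on with
  | empty => simp
  | insert a s ha ih => rw [Finset.sum_insert ha, Finset.prod_insert ha, expNeg_add, ih]

theorem expNeg_mul_natCast (x : ℝ≥0∞) (n : ℕ) : expNeg (x * n) = expNeg x ^ n := by
  have := expNeg_sum (Finset.range n) (fun _ => x)
  simpa [mul_comm] using this

theorem tendsto_prod_expNeg (f : ℕ → ℝ≥0∞) :
    Tendsto (fun n => ∏ i ∈ Finset.range n, expNeg (f i)) atTop (𝓝 (expNeg (∑' i, f i))) := by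
  simp_rw [← expNeg_sum]
  exact (continuous_expNeg.tendsto _).comp ENNReal.summable.hasSum.tendsto_sum_nat

/-- Inverse of `expNeg` on `[0, 1]`. -/
noncomputable def negLog (x : ℝ≥0∞) : ℝ≥0∞ := (-ENNReal.log x).toENNReal

theorem measurable_negLog : Measurable negLog := by
  unfold negLog
  exact measurable_ereal_toENNReal.comp
    (continuous_neg.measurable.comp ENNReal.measurable_log)

theorem expNeg_negLog {x : ℝ≥0∞} (hx : x ≤ 1) : expNeg (negLog x) = x := by
  have h : 0 ≤ -ENNReal.log x := by
    rw [EReal.le_neg, neg_zero, ← ENNReal.log_one]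
    exact ENNReal.log_monotone hx
  rw [expNeg, negLog, EReal.coe_toENNReal h, neg_neg, ENNReal.exp_log]

/-! ### Laplace functional of a Poisson process -/

/-- This is the Poisson generating function `exp (-m (1 - y))` at `y = exp (-c)`, summed from the
exponential series. The value `c = ∞` is allowed and corresponds to `y = 0`. -/
theorem lintegral_expNeg_mul_poissonMeasure (m : NNReal) (c : ℝ≥0∞) :
    ∫⁻ x, expNeg (c * x) ∂((poissonMeasure m).map (Nat.cast : ℕ → ℝ≥0∞))
      = expNeg (m * (1 - expNeg c)) := by
  rw [lintegral_map (f := fun x => expNeg (c * x))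
    (measurable_expNeg.comp (measurable_const_mul c)) .of_discrete,
    poissonMeasure, lintegral_sum_measure]
  simp_rw [lintegral_smul_measure, lintegral_dirac, expNeg_mul_natCast]
  obtain ⟨y, hy⟩ : ∃ y : NNReal, (y : ℝ≥0∞) = expNeg c :=
    ⟨_, ENNReal.coe_toNNReal (expNeg_ne_top c)⟩
  have hy1 : (y : ℝ) ≤ 1 := by
    have := expNeg_le_one c
    rw [← hy] at this
    exact_mod_cast this
  have h1 : HasSum (fun n : ℕ => Real.exp (-m) * (m * y : ℝ) ^ n / n.factorial)
      (Real.exp (-(m * (1 - y)))) := by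
    have h2 := (NormedSpace.expSeries_div_hasSum_exp ((m : ℝ) * y)).mul_left (Real.exp (-m))
    rw [← Real.exp_eq_exp_ℝ, ← Real.exp_add] at h2
    convert! h2 using 1
    · funext n; ring
    · congr 1; ring
  have h3 : (m : ℝ≥0∞) * (1 - expNeg c) = ENNReal.ofReal (m * (1 - y)) := by
    rw [ENNReal.ofReal_mul (by positivity), ENNReal.ofReal_sub _ (by positivity), ← hy]
    simp
  rw [h3, expNeg_ofReal (mul_nonneg (by positivity) (by linarith)), ← h1.tsum_eq,
    ENNReal.ofReal_tsum_of_nonneg (fun n => by positivity) h1.summable]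
  refine tsum_congr fun n => ?_
  rw [← hy, smul_eq_mul, ← ENNReal.ofReal_coe_nnreal, ← ENNReal.ofReal_pow (by positivity),
    ← ENNReal.ofReal_mul (by positivity)]
  congr 1
  ring

theorem lintegral_sum_dirac {Ω S : Type*} [MeasurableSpace S] {X : ℕ → Ω → S}
    {u : S → ℝ≥0∞} (hu : Measurable u) (ω : Ω) :
    ∫⁻ x, u x ∂(Measure.sum fun m => Measure.dirac (X m ω)) = ∑' m, u (X m ω) := by
  rw [lintegral_sum_measure]
  exact tsum_congr fun m => lintegral_dirac' _ hu

section Laplace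

variable {Ω S : Type*} [MeasurableSpace Ω] [MeasurableSpace S] {X : ℕ → Ω → S} {Λ : Measure S}
  {P : Measure Ω}

theorem measurable_pointCount (hX : ∀ m, Measurable (X m)) {B : Set S} (hB : MeasurableSet B) :
    Measurable (pointCount X B) := by
  unfold pointCount
  simp_rw [Measure.sum_apply _ hB, Measure.dirac_apply' _ hB]
  exact Measurable.tsum fun m => (measurable_one.indicator hB).comp (hX m)

/-- Laplace functional of a Poisson process, simple functions. -/
theorem IsPoissonPointProcess.lintegral_expNeg_simpleFunc (hX : IsPoissonPointProcess X Λ P)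
    (g : SimpleFunc S ℝ≥0∞) (hg : ∀ c, c ≠ 0 → Λ (g ⁻¹' {c}) ≠ ⊤) :
    ∫⁻ ω, expNeg (∑' m, g (X m ω)) ∂P = expNeg (∫⁻ x, 1 - expNeg (g x) ∂Λ) := by
  classical
  -- The value `0` is discarded: its level set may have infinite intensity, and it contributes
  -- nothing to either side.
  set s := g.range.filter (· ≠ 0) with hs
  -- Used twice: with the counting measure of the points and `f` the identity, and with `Λ` and `f x
  -- = 1 - expNeg x`.
  have hsum : ∀ (μ : Measure S) (f : ℝ≥0∞ → ℝ≥0∞), f 0 = 0 →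
      ∫⁻ x, f (g x) ∂μ = ∑ i : Fin s.card, f (s.equivFin.symm i) *
        μ (g ⁻¹' {(s.equivFin.symm i : ℝ≥0∞)}) := by
    intro μ f hf
    have h1 := SimpleFunc.lintegral_eq_lintegral (g.map f) μ
    simp only [SimpleFunc.map_apply] at h1
    rw [h1, SimpleFunc.map_lintegral,
      Equiv.sum_comp s.equivFin.symm (fun c : s => f c * μ (g ⁻¹' {(c : ℝ≥0∞)})),
      Finset.sum_coe_sort s (fun c => f c * μ (g ⁻¹' {c})), hs, Finset.sum_filter]
    refine Finset.sum_congr rfl fun c _ => ?_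
    split_ifs with h
    · rfl
    · rw [not_not.1 h, hf, zero_mul]
  set B : Fin s.card → Set S := fun i => g ⁻¹' {(s.equivFin.symm i : ℝ≥0∞)} with hB
  have hBm : ∀ i, MeasurableSet (B i) := fun i => g.measurableSet_fiber _
  have hBf : ∀ i, Λ (B i) ≠ ⊤ := fun i =>
    hg _ (Finset.mem_filter.1 (s.equivFin.symm i).2).2
  have hBd : Pairwise (fun i j => Disjoint (B i) (B j)) := fun i j hij =>
    Disjoint.preimage _ (Set.disjoint_singleton.2 fun h =>
      hij (s.equivFin.symm.injective (Subtype.ext h)))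
  have hind := hX.indep_count _ B hBm hBf hBd
  have h1 : ∀ ω, expNeg (∑' m, g (X m ω))
      = ∏ i, expNeg ((s.equivFin.symm i : ℝ≥0∞) * pointCount X (B i) ω) := by
    intro ω
    rw [← lintegral_sum_dirac g.measurable, hsum _ (fun x => x) rfl, expNeg_sum]
    rfl
  simp_rw [h1]
  rw [lintegral_prod_eq_prod_lintegral_of_indepFun Finset.univ
    (fun i ω => expNeg ((s.equivFin.symm i : ℝ≥0∞) * pointCount X (B i) ω))
    (hind.comp (fun i x => expNeg ((s.equivFin.symm i : ℝ≥0∞) * x))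
      fun i => measurable_expNeg.comp (measurable_const_mul _))
    fun i => measurable_expNeg.comp
      ((measurable_pointCount hX.measurable (hBm i)).const_mul _),
    hsum Λ (fun x => 1 - expNeg x) (by simp), expNeg_sum]
  refine Finset.prod_congr rfl fun i _ => ?_
  rw [(hX.count_law (B i) (hBm i) (hBf i)).lintegral_comp
    (f := fun x => expNeg ((s.equivFin.symm i : ℝ≥0∞) * x))
    (measurable_expNeg.comp (measurable_const_mul _)).aemeasurable,
    lintegral_expNeg_mul_poissonMeasure, ENNReal.coe_toNNReal (hBf i), mul_comm]

/-- A measurable function is an increasing limit of simple functions that are supported on sets of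
finite measure. -/
theorem exists_simpleFunc_monotone_tendsto (Λ : Measure S) [SigmaFinite Λ] {u : S → ℝ≥0∞}
    (hu : Measurable u) : ∃ g : ℕ → SimpleFunc S ℝ≥0∞,
      (∀ n c, c ≠ 0 → Λ (g n ⁻¹' {c}) ≠ ⊤) ∧ (∀ x, Monotone fun n => g n x) ∧
      ∀ x, Tendsto (fun n => g n x) atTop (𝓝 (u x)) := by
  have hm := measurableSet_spanningSets Λ
  refine ⟨fun n => (SimpleFunc.eapprox u n).restrict (spanningSets Λ n), fun n c hc => ?_,
    fun x n m hnm => ?_, fun x => ?_⟩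
  · refine ne_top_of_le_ne_top (measure_spanningSets_lt_top Λ n).ne (measure_mono fun x hx => ?_)
    by_contra h
    simp only [Set.mem_preimage, SimpleFunc.restrict_apply _ (hm n),
      Set.indicator_of_notMem h, Set.mem_singleton_iff] at hx
    exact hc hx.symm
  · simp only [SimpleFunc.restrict_apply _ (hm _)]
    by_cases h : x ∈ spanningSets Λ n
    · rw [Set.indicator_of_mem h, Set.indicator_of_mem (monotone_spanningSets Λ hnm h)]
      exact SimpleFunc.monotone_eapprox u hnm x
    · rw [Set.indicator_of_notMem h]
      exact zero_le
  · have h1 : Tendsto (fun n => SimpleFunc.eapprox u n x) atTop (𝓝 (u x)) := by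
      rw [← SimpleFunc.iSup_eapprox_apply hu x]
      exact tendsto_atTop_iSup fun n m hnm => SimpleFunc.monotone_eapprox u hnm x
    refine h1.congr' ?_
    obtain ⟨k, hk⟩ := Set.mem_iUnion.1 ((iUnion_spanningSets Λ).symm ▸ Set.mem_univ x)
    filter_upwards [eventually_ge_atTop k] with n hn
    rw [SimpleFunc.restrict_apply _ (hm n),
      Set.indicator_of_mem (monotone_spanningSets Λ hn hk)]

/-- Laplace functional of a Poisson process. -/
theorem IsPoissonPointProcess.lintegral_expNeg [IsProbabilityMeasure P] [SigmaFinite Λ]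
    (hX : IsPoissonPointProcess X Λ P) {u : S → ℝ≥0∞} (hu : Measurable u) :
    ∫⁻ ω, expNeg (∑' m, u (X m ω)) ∂P = expNeg (∫⁻ x, 1 - expNeg (u x) ∂Λ) := by
  obtain ⟨g, hgf, hgm, hgt⟩ := exists_simpleFunc_monotone_tendsto Λ hu
  have hl : Tendsto (fun n => ∫⁻ ω, expNeg (∑' m, g n (X m ω)) ∂P) atTop
      (𝓝 (∫⁻ ω, expNeg (∑' m, u (X m ω)) ∂P)) := by
    -- The integrands decrease in `n`, so domination by `1` is used here; the sums inside the
    -- exponential converge monotonically.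
    refine tendsto_lintegral_of_dominated_convergence (fun _ => 1) (fun n => ?_)
      (fun n => ae_of_all _ fun ω => expNeg_le_one _) (by simp) (ae_of_all _ fun ω => ?_)
    · exact measurable_expNeg.comp (Measurable.tsum fun m =>
        (g n).measurable.comp (hX.measurable m))
    · refine (continuous_expNeg.tendsto _).comp ?_
      simp_rw [← lintegral_sum_dirac hu, ← lintegral_sum_dirac (g _).measurable]
      exact lintegral_tendsto_of_tendsto_of_monotone (fun n => (g n).measurable.aemeasurable)
        (ae_of_all _ hgm) (ae_of_all _ hgt)
  have hr : Tendsto (fun n => expNeg (∫⁻ x, 1 - expNeg (g n x) ∂Λ)) atTop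
      (𝓝 (expNeg (∫⁻ x, 1 - expNeg (u x) ∂Λ))) := by
    refine (continuous_expNeg.tendsto _).comp ?_
    refine lintegral_tendsto_of_tendsto_of_monotone (fun n => ?_) (ae_of_all _ fun x => ?_)
      (ae_of_all _ fun x => ?_)
    · exact (measurable_const.sub (measurable_expNeg.comp (g n).measurable)).aemeasurable
    · exact fun n m hnm => tsub_le_tsub_left (expNeg_antitone (hgm x hnm)) _
    · exact ENNReal.Tendsto.sub tendsto_const_nhds
        ((continuous_expNeg.tendsto _).comp (hgt x)) (Or.inl ENNReal.one_ne_top)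
  refine tendsto_nhds_unique hl (hr.congr fun n => ?_)
  rw [hX.lintegral_expNeg_simpleFunc (g n) (hgf n)]

/-- Laplace functional of a Poisson process with independent identically distributed marks. -/
theorem IsPoissonPointProcess.lintegral_expNeg_marked {T : Type*} [MeasurableSpace T]
    [IsProbabilityMeasure P] [SigmaFinite Λ] (hX : IsPoissonPointProcess X Λ P)
    {M : ℕ → Ω → T} {ν : Measure T} [IsProbabilityMeasure ν] (hM : ∀ m, Measurable (M m))
    (hν : ∀ m, HasLaw (M m) ν P) (hMi : iIndepFun M P)
    (hXM : IndepFun (fun ω m => X m ω) (fun ω m => M m ω) P)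
    {h : S → T → ℝ≥0∞} (hh : Measurable (Function.uncurry h)) :
    ∫⁻ ω, expNeg (∑' m, h (X m ω) (M m ω)) ∂P
      = expNeg (∫⁻ x, 1 - ∫⁻ t, expNeg (h x t) ∂ν ∂Λ) := by
  set φ : S → ℝ≥0∞ := fun x => ∫⁻ t, expNeg (h x t) ∂ν with hφ
  have hφm : Measurable φ := Measurable.lintegral_prod_right'
    (f := fun z : S × T => expNeg (h z.1 z.2)) (measurable_expNeg.comp hh)
  have hφ1 : ∀ x, φ x ≤ 1 := fun x => by
    refine (lintegral_mono fun t => expNeg_le_one _).trans ?_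
    simp
  have hXm : Measurable fun ω m => X m ω := measurable_pi_lambda _ hX.measurable
  have hMm : Measurable fun ω m => M m ω := measurable_pi_lambda _ hM
  -- Freeze the points, which are independent of the marks, and average over the marks by Fubini.
  -- Their mutual independence factorizes finite products only, hence the truncation at `n`.
  have hfin : ∀ n, ∫⁻ ω, ∏ m ∈ Finset.range n, expNeg (h (X m ω) (M m ω)) ∂P
      = ∫⁻ ω, ∏ m ∈ Finset.range n, φ (X m ω) ∂P := by
    intro n
    set F : (ℕ → S) × (ℕ → T) → ℝ≥0∞ :=
      fun z => ∏ m ∈ Finset.range n, expNeg (h (z.1 m) (z.2 m)) with hF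
    have hFm : Measurable F := Finset.measurable_prod _ fun m _ =>
      measurable_expNeg.comp (hh.comp (g := Function.uncurry h)
        (f := fun z : (ℕ → S) × (ℕ → T) => (z.1 m, z.2 m))
        (((measurable_pi_apply m).comp measurable_fst).prodMk
          ((measurable_pi_apply m).comp measurable_snd)))
    have h1 := (indepFun_iff_map_prod_eq_prod_map_map hXm.aemeasurable hMm.aemeasurable).1 hXM
    calc ∫⁻ ω, ∏ m ∈ Finset.range n, expNeg (h (X m ω) (M m ω)) ∂P
        = ∫⁻ z, F z ∂(P.map fun ω => ((fun m => X m ω), fun m => M m ω)) :=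
          (lintegral_map hFm (hXm.prodMk hMm)).symm
      _ = ∫⁻ ω, ∫⁻ ω', F ((fun m => X m ω), fun m => M m ω') ∂P ∂P := by
          have := Measure.isProbabilityMeasure_map (μ := P) hMm.aemeasurable
          rw [h1, lintegral_prod _ hFm.aemeasurable, lintegral_map hFm.lintegral_prod_right' hXm]
          refine lintegral_congr fun ω => ?_
          rw [lintegral_map (f := fun y => F ((fun m => X m ω), y))
            (hFm.comp measurable_prodMk_left) hMm]
      _ = ∫⁻ ω, ∏ m ∈ Finset.range n, φ (X m ω) ∂P := by
          refine lintegral_congr fun ω => ?_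
          have hm : ∀ m, Measurable fun t => expNeg (h (X m ω) t) := fun m =>
            measurable_expNeg.comp (hh.comp measurable_prodMk_left)
          rw [hF]
          refine (lintegral_prod_eq_prod_lintegral_of_indepFun (Finset.range n)
            (fun m ω' => expNeg (h (X m ω) (M m ω')))
            (hMi.comp (fun m t => expNeg (h (X m ω) t)) hm) fun m => (hm m).comp (hM m)).trans ?_
          exact Finset.prod_congr rfl fun m _ => (hν m).lintegral_comp (hm m).aemeasurable
  have hl : Tendsto (fun n => ∫⁻ ω, ∏ m ∈ Finset.range n, expNeg (h (X m ω) (M m ω)) ∂P) atTop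
      (𝓝 (∫⁻ ω, expNeg (∑' m, h (X m ω) (M m ω)) ∂P)) := by
    refine tendsto_lintegral_of_dominated_convergence (fun _ => 1) (fun n => ?_)
      (fun n => ae_of_all _ fun ω => Finset.prod_le_one' fun m _ => expNeg_le_one _) (by simp)
      (ae_of_all _ fun ω => tendsto_prod_expNeg _)
    exact Finset.measurable_prod _ fun m _ =>
      measurable_expNeg.comp (hh.comp ((hX.measurable m).prodMk (hM m)))
  -- Writing `φ` as `expNeg (negLog φ)` makes the averaged product an unmarked functional, to which
  -- the previous theorem applies; `negLog φ` is infinite where `φ` vanishes.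
  have hr : Tendsto (fun n => ∫⁻ ω, ∏ m ∈ Finset.range n, φ (X m ω) ∂P) atTop
      (𝓝 (∫⁻ ω, expNeg (∑' m, negLog (φ (X m ω))) ∂P)) := by
    refine tendsto_lintegral_of_dominated_convergence (fun _ => 1) (fun n => ?_)
      (fun n => ae_of_all _ fun ω => Finset.prod_le_one' fun m _ => hφ1 _) (by simp)
      (ae_of_all _ fun ω => ?_)
    · exact Finset.measurable_prod _ fun m _ => hφm.comp (hX.measurable m)
    · simpa only [expNeg_negLog (hφ1 _)] using tendsto_prod_expNeg fun m => negLog (φ (X m ω))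
  rw [tendsto_nhds_unique hl (hr.congr fun n => (hfin n).symm),
    hX.lintegral_expNeg (u := fun x => negLog (φ x)) (measurable_negLog.comp hφm)]
  simp_rw [expNeg_negLog (hφ1 _), hφ]

end Laplace

/-! ### Rayleigh fading -/

theorem setLIntegral_Ioi_mul_exp_neg_mul_sq {β a : ℝ} (hβ : 0 < β) (ha : 0 ≤ a) :
    ∫⁻ x in Set.Ioi a, ENNReal.ofReal (x * Real.exp (-β * x ^ 2))
      = ENNReal.ofReal (Real.exp (-β * a ^ 2) / (2 * β)) := by
  have hd : ∀ x ∈ Set.Ici a, HasDerivAt (fun x => -(Real.exp (-β * x ^ 2) / (2 * β)))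
      (x * Real.exp (-β * x ^ 2)) x := by
    intro x _
    have h1 : HasDerivAt (fun x : ℝ => -β * x ^ 2) (-β * (2 * x)) x := by
      simpa using (hasDerivAt_pow 2 x).const_mul (-β)
    refine (h1.exp.div_const (2 * β)).neg.congr_deriv ?_
    field_simp
  have hpos : ∀ x ∈ Set.Ioi a, 0 ≤ x * Real.exp (-β * x ^ 2) := fun x hx =>
    mul_nonneg (ha.trans (le_of_lt hx)) (Real.exp_nonneg _)
  have hlim : Tendsto (fun x : ℝ => -(Real.exp (-β * x ^ 2) / (2 * β))) atTop (𝓝 0) := by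
    have h1 : Tendsto (fun x : ℝ => -β * x ^ 2) atTop atBot :=
      (tendsto_pow_atTop two_ne_zero).const_mul_atTop_of_neg (neg_lt_zero.2 hβ)
    simpa using ((Real.tendsto_exp_atBot.comp h1).div_const (2 * β)).neg
  rw [← ofReal_integral_eq_lintegral_ofReal (integrableOn_Ioi_deriv_of_nonneg' hd hpos hlim)
    ((ae_restrict_iff' measurableSet_Ioi).2 (ae_of_all _ hpos)),
    integral_Ioi_of_hasDerivAt_of_nonneg' hd hpos hlim, zero_sub, neg_neg]

/-- The density is put in the form `x * exp (-β * x ^ 2)` on the half-line, so that a factor `exp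
(-k * x ^ 2)` merely shifts `β` to `β + k`. -/
theorem lintegral_rayleigh (s : ℝ) {f : ℝ → ℝ≥0∞} (hf : Measurable f) :
    ∫⁻ x, f x ∂rayleigh s = ENNReal.ofReal (1 / s ^ 2) *
      ∫⁻ x in Set.Ioi 0, ENNReal.ofReal (x * Real.exp (-(1 / (2 * s ^ 2)) * x ^ 2)) * f x := by
  have hm : Measurable fun x : ℝ =>
      ENNReal.ofReal (if 0 ≤ x then x / s ^ 2 * Real.exp (-x ^ 2 / (2 * s ^ 2)) else 0) :=
    ENNReal.measurable_ofReal.comp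
      (Measurable.ite measurableSet_Ici (by fun_prop) measurable_const)
  rw [rayleigh, lintegral_withDensity_eq_lintegral_mul _ hm hf,
    ← lintegral_const_mul _ (by fun_prop), ← lintegral_indicator measurableSet_Ioi]
  refine lintegral_congr fun x => ?_
  simp only [Pi.mul_apply, Set.indicator_apply, Set.mem_Ioi]
  rcases lt_trichotomy x 0 with h | h | h
  · simp [h.not_ge, h.not_gt]
  · simp [h]
  · rw [if_pos h.le, if_pos h, ← mul_assoc, ← ENNReal.ofReal_mul (by positivity)]
    congr 2
    rw [← mul_assoc, show -x ^ 2 / (2 * s ^ 2) = -(1 / (2 * s ^ 2)) * x ^ 2 by ring]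
    ring

/-- Only the trace of `A` on the positive axis matters. This is needed because the success event is
stated through `x ^ 2` and so also contains negative `x`. -/
theorem rayleigh_eq_of_inter_Ioi {s a : ℝ} (hs : 0 < s) (ha : 0 ≤ a) {A : Set ℝ}
    (hA : MeasurableSet A) (h : ∀ x, 0 < x → (x ∈ A ↔ a < x)) :
    rayleigh s A = ENNReal.ofReal (Real.exp (-(a ^ 2 / (2 * s ^ 2)))) := by
  rw [← lintegral_indicator_one hA, lintegral_rayleigh s (measurable_one.indicator hA)]
  have h1 : ∫⁻ x in Set.Ioi 0, ENNReal.ofReal (x * Real.exp (-(1 / (2 * s ^ 2)) * x ^ 2)) *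
      A.indicator 1 x
      = ∫⁻ x in Set.Ioi a, ENNReal.ofReal (x * Real.exp (-(1 / (2 * s ^ 2)) * x ^ 2)) := by
    rw [← lintegral_indicator measurableSet_Ioi, ← lintegral_indicator measurableSet_Ioi]
    refine lintegral_congr fun x => ?_
    simp only [Set.indicator_apply, Set.mem_Ioi]
    by_cases hx : 0 < x
    · rw [if_pos hx]
      by_cases hax : a < x
      · rw [if_pos hax, Set.indicator_of_mem ((h x hx).2 hax), Pi.one_apply, mul_one]
      · rw [if_neg hax, Set.indicator_of_notMem (mt (h x hx).1 hax), mul_zero]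
    · rw [if_neg hx, if_neg fun hax => hx (ha.trans_lt hax)]
  rw [h1, setLIntegral_Ioi_mul_exp_neg_mul_sq (by positivity) ha,
    ← ENNReal.ofReal_mul (by positivity)]
  congr 1
  field_simp

theorem isProbabilityMeasure_rayleigh {s : ℝ} (hs : 0 < s) :
    IsProbabilityMeasure (rayleigh s) :=
  ⟨by rw [rayleigh_eq_of_inter_Ioi hs le_rfl MeasurableSet.univ (by simp)]; simp⟩

/-- Laplace transform of the squared modulus of a Rayleigh fading coefficient. -/
theorem lintegral_expNeg_rayleigh {s k : ℝ} (hs : 0 < s) (hk : 0 ≤ k) :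
    ∫⁻ x, expNeg (ENNReal.ofReal (k * x ^ 2)) ∂rayleigh s
      = ENNReal.ofReal (1 / (1 + 2 * s ^ 2 * k)) := by
  rw [lintegral_rayleigh s (f := fun x => expNeg (ENNReal.ofReal (k * x ^ 2)))
    (measurable_expNeg.comp (by fun_prop))]
  have h1 : ∀ x : ℝ, ENNReal.ofReal (x * Real.exp (-(1 / (2 * s ^ 2)) * x ^ 2)) *
      expNeg (ENNReal.ofReal (k * x ^ 2))
      = ENNReal.ofReal (x * Real.exp (-(1 / (2 * s ^ 2) + k) * x ^ 2)) := by
    intro x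
    rw [expNeg_ofReal (by positivity), ← ENNReal.ofReal_mul' (Real.exp_nonneg _), mul_assoc,
      ← Real.exp_add]
    ring_nf
  simp_rw [h1]
  rw [setLIntegral_Ioi_mul_exp_neg_mul_sq (by positivity) le_rfl,
    ← ENNReal.ofReal_mul (by positivity)]
  congr 1
  simp only [ne_eq, OfNat.ofNat_ne_zero, not_false_eq_true, zero_pow, mul_zero, Real.exp_zero]
  field_simp

/-- Success probability given the interference power `i`. -/
theorem rayleigh_ofReal_lt_div {s θ D : ℝ} (hs : 0 < s) (hθ : 0 < θ) (hD : 0 < D) (i : ℝ≥0∞) :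
    rayleigh s {x | ENNReal.ofReal θ < ENNReal.ofReal (D * x ^ 2) / i}
      = expNeg (ENNReal.ofReal (θ / (2 * s ^ 2 * D)) * i) := by
  have hm : MeasurableSet {x : ℝ | ENNReal.ofReal θ < ENNReal.ofReal (D * x ^ 2) / i} :=
    measurableSet_lt measurable_const (by fun_prop)
  rcases eq_or_ne i ⊤ with rfl | hi
  · rw [ENNReal.mul_top (by simpa using by positivity), expNeg_top]
    simp
  · obtain ⟨y, hy, rfl⟩ : ∃ y : ℝ, 0 ≤ y ∧ i = ENNReal.ofReal y :=
      ⟨i.toReal, ENNReal.toReal_nonneg, (ENNReal.ofReal_toReal hi).symm⟩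
    rw [rayleigh_eq_of_inter_Ioi hs (Real.sqrt_nonneg (θ * y / D)) hm, Real.sq_sqrt (by positivity),
      ← ENNReal.ofReal_mul (by positivity), expNeg_ofReal (by positivity)]
    · congr 3
      field_simp
    · intro x hx
      simp only [Set.mem_ofPred_eq]
      rcases hy.eq_or_lt with rfl | hy
      -- Without interference the ratio is `∞` for every `x > 0`, so success is almost sure.
      · simp only [ENNReal.ofReal_zero, mul_zero, zero_div, Real.sqrt_zero, hx, iff_true]
        rw [ENNReal.div_zero (by simpa using by positivity)]
        exact ENNReal.ofReal_lt_top
      · rw [← ENNReal.ofReal_div_of_pos hy, ENNReal.ofReal_lt_ofReal_iff (by positivity),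
          Real.sqrt_lt' hx, lt_div_iff₀ hy, div_lt_iff₀ hD, mul_comm D]

/-! ### The interference integral -/

theorem setLIntegral_rpow_mul_exp_neg_mul_rpow {p q b : ℝ} (hp : 0 < p) (hq : -1 < q)
    (hb : 0 < b) :
    ∫⁻ x in Set.Ioi 0, ENNReal.ofReal (x ^ q * Real.exp (-b * x ^ p))
      = ENNReal.ofReal (b ^ (-(q + 1) / p) * (1 / p) * Real.Gamma ((q + 1) / p)) := by
  rw [← integral_rpow_mul_exp_neg_mul_rpow hp hq hb]
  refine (ofReal_integral_eq_lintegral_ofReal (integrableOn_rpow_mul_exp_neg_mul_rpow hq hp hb)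
    ((ae_restrict_iff' measurableSet_Ioi).2 (ae_of_all _ fun x hx => ?_))).symm
  have : (0 : ℝ) < x := hx
  positivity

theorem sin_two_pi_div_pos {α : ℝ} (hα : 2 < α) : 0 < Real.sin (2 * Real.pi / α) := by
  have := Real.pi_pos
  refine Real.sin_pos_of_pos_of_lt_pi (by positivity) ?_
  rw [div_lt_iff₀ (by linarith)]
  nlinarith

/-- Write `1 / (K + t ^ α)` as the integral of `exp (-(K + t ^ α) * v)` over `v > 0` and swap by
Tonelli. The `t`-integral gives `Γ(2/α)`, the `v`-integral gives `Γ(1 - 2/α)`, and the reflection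
formula gives the sine. Finiteness of the second needs `α > 2`. -/
theorem setLIntegral_mul_div_add_rpow {α K : ℝ} (hα : 2 < α) (hK : 0 < K) :
    ∫⁻ t in Set.Ioi 0, ENNReal.ofReal (t * (K / (K + t ^ α)))
      = ENNReal.ofReal (K ^ (2 / α) * (Real.pi / (α * Real.sin (2 * Real.pi / α)))) := by
  have hα0 : 0 < α := by linarith
  have h2α : 2 / α < 1 := (div_lt_one hα0).2 hα
  have h1 : ∀ t ∈ Set.Ioi (0 : ℝ), ENNReal.ofReal (t * (K / (K + t ^ α)))
      = ∫⁻ v in Set.Ioi (0 : ℝ), ENNReal.ofReal (K * t * Real.exp (-(K + t ^ α) * v)) := by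
    intro t (ht : 0 < t)
    have h := setLIntegral_rpow_mul_exp_neg_mul_rpow (p := 1) (q := 0) (b := K + t ^ α)
      one_pos (by norm_num) (by positivity)
    simp only [Real.rpow_zero, Real.rpow_one, one_mul, zero_add, div_one, Real.Gamma_one, mul_one,
      Real.rpow_neg_one] at h
    simp_rw [ENNReal.ofReal_mul (show 0 ≤ K * t by positivity)]
    rw [lintegral_const_mul _ (by fun_prop), h, ← ENNReal.ofReal_mul (by positivity)]
    congr 1
    field_simp
  have h2 : ∀ v ∈ Set.Ioi (0 : ℝ),
      ∫⁻ t in Set.Ioi (0 : ℝ), ENNReal.ofReal (K * t * Real.exp (-(K + t ^ α) * v))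
      = ENNReal.ofReal (K / α * Real.Gamma (2 / α)) *
        ENNReal.ofReal (v ^ (-(2 / α)) * Real.exp (-K * v ^ (1 : ℝ))) := by
    intro v (hv : 0 < v)
    have h := setLIntegral_rpow_mul_exp_neg_mul_rpow (p := α) (q := 1) (b := v)
      hα0 (by norm_num) hv
    have h3 : ∀ t : ℝ, ENNReal.ofReal (K * t * Real.exp (-(K + t ^ α) * v))
        = ENNReal.ofReal (K * Real.exp (-K * v)) *
          ENNReal.ofReal (t ^ (1 : ℝ) * Real.exp (-v * t ^ α)) := by
      intro t
      rw [← ENNReal.ofReal_mul (by positivity), Real.rpow_one,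
        show -(K + t ^ α) * v = -K * v + -v * t ^ α by ring, Real.exp_add]
      ring_nf
    have hG := (Real.Gamma_pos_of_pos (show 0 < 2 / α by positivity)).le
    simp_rw [h3]
    rw [lintegral_const_mul _ (by fun_prop), h, ← ENNReal.ofReal_mul (by positivity),
      ← ENNReal.ofReal_mul (by positivity), Real.rpow_one, one_add_one_eq_two, neg_div]
    ring_nf
  have hm : Measurable fun z : ℝ × ℝ =>
      ENNReal.ofReal (K * z.1 * Real.exp (-(K + z.1 ^ α) * z.2)) := by fun_prop
  rw [setLIntegral_congr_fun measurableSet_Ioi h1, lintegral_lintegral_swap hm.aemeasurable,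
    setLIntegral_congr_fun measurableSet_Ioi h2, lintegral_const_mul _ (by fun_prop),
    setLIntegral_rpow_mul_exp_neg_mul_rpow one_pos (by linarith) hK,
    ← ENNReal.ofReal_mul (mul_nonneg (by positivity)
      (Real.Gamma_pos_of_pos (by positivity)).le)]
  congr 1
  have hg := Real.Gamma_mul_Gamma_one_sub (2 / α)
  simp only [div_one, mul_one]
  rw [neg_add_eq_sub, neg_sub, Real.rpow_sub_one hK.ne']
  have hs := sin_two_pi_div_pos hα
  rw [show Real.pi * (2 / α) = 2 * Real.pi / α by ring] at hg
  calc K / α * Real.Gamma (2 / α) * (K ^ (2 / α) / K * Real.Gamma (1 - 2 / α))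
      = K ^ (2 / α) / α * (Real.Gamma (2 / α) * Real.Gamma (1 - 2 / α)) := by field_simp
    _ = _ := by rw [hg]; field_simp

theorem kappa_pos {α : ℝ} (hα : 2 < α) : 0 < kappa α := by
  have := sin_two_pi_div_pos hα
  have := Real.pi_pos
  have : 0 < α := by linarith
  unfold kappa
  positivity

/-- The interference integral over the plane. -/
theorem lintegral_plane_one_sub {α K : ℝ} (hα : 2 < α) (hK : 0 < K) (a : Plane) :
    ∫⁻ x : Plane, ENNReal.ofReal (1 - 1 / (1 + K * dist a x ^ (-α)))
      = ENNReal.ofReal (K ^ (2 / α) * kappa α) := by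
  have h0 : ∀ t : ℝ, 0 ≤ t → 0 ≤ 1 - 1 / (1 + K * t ^ (-α)) := fun t ht => by
    have : 0 ≤ K * t ^ (-α) := by positivity
    rw [sub_nonneg, div_le_one (by positivity)]
    linarith
  -- The factor `t ^ (2 - 1)` is the polar Jacobian in dimension two; the angular factor `2π` later
  -- comes from the dimension times the area of the unit disc.
  have h1 : ∀ t ∈ Set.Ioi (0 : ℝ), t * (K / (K + t ^ α))
      = t ^ (2 - 1) • (1 - 1 / (1 + K * t ^ (-α))) := by
    intro t (ht : 0 < t)
    have : 0 < t ^ α := by positivity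
    rw [Real.rpow_neg ht.le, smul_eq_mul]
    field_simp
    ring
  have hnn : 0 ≤ᵐ[volume.restrict (Set.Ioi (0 : ℝ))] fun t => t * (K / (K + t ^ α)) :=
    (ae_restrict_iff' measurableSet_Ioi).2 (ae_of_all _ fun t (ht : 0 < t) => by
      change 0 ≤ t * (K / (K + t ^ α))
      positivity)
  have hval := setLIntegral_mul_div_add_rpow hα hK
  have hI : IntegrableOn (fun t : ℝ => t * (K / (K + t ^ α))) (Set.Ioi 0) :=
    (lintegral_ofReal_ne_top_iff_integrable (by fun_prop) hnn).1
      (by rw [hval]; exact ENNReal.ofReal_ne_top)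
  have hint : ∫ t in Set.Ioi (0 : ℝ), t * (K / (K + t ^ α))
      = K ^ (2 / α) * (Real.pi / (α * Real.sin (2 * Real.pi / α))) := by
    have hs := sin_two_pi_div_pos hα
    have := Real.pi_pos
    have : 0 < α := by linarith
    rw [integral_eq_lintegral_of_nonneg_ae hnn (by fun_prop), hval,
      ENNReal.toReal_ofReal (by positivity)]
  have hdim : Module.finrank ℝ Plane = 2 := by simp
  have hP : Integrable (fun x : Plane => 1 - 1 / (1 + K * ‖x‖ ^ (-α))) := by
    rw [integrable_fun_norm_addHaar (E := Plane) volume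
      (f := fun t => 1 - 1 / (1 + K * t ^ (-α))), hdim]
    exact hI.congr_fun h1 measurableSet_Ioi
  have htr : ∫⁻ x : Plane, ENNReal.ofReal (1 - 1 / (1 + K * dist a x ^ (-α)))
      = ∫⁻ x : Plane, ENNReal.ofReal (1 - 1 / (1 + K * ‖x‖ ^ (-α))) := by
    simp_rw [dist_eq_norm]
    exact lintegral_sub_left_eq_self
      (fun x : Plane => ENNReal.ofReal (1 - 1 / (1 + K * ‖x‖ ^ (-α)))) a
  rw [htr, ← ofReal_integral_eq_lintegral_ofReal hP (ae_of_all _ fun x => h0 _ (norm_nonneg x)),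
    integral_fun_norm_addHaar (E := Plane) volume (fun t => 1 - 1 / (1 + K * t ^ (-α))), hdim,
    ← setIntegral_congr_fun measurableSet_Ioi h1, hint, measureReal_def,
    EuclideanSpace.volume_ball_fin_two]
  congr 1
  have := Real.pi_pos
  simp only [ENNReal.ofReal_one, one_pow, one_mul, ENNReal.toReal_ofReal this.le, kappa,
    smul_eq_mul, nsmul_eq_mul]
  push_cast
  ring

/-! ### Success probability -/

theorem lintegral_bernoulliMeasure (a : unitInterval) (f : Bool → ℝ≥0∞) :
    ∫⁻ x, f x ∂bernoulliMeasure true false a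
      = ENNReal.ofReal a * f true + ENNReal.ofReal (1 - a) * f false := by
  have h : ∀ a : unitInterval, ENNReal.ofReal a = (unitInterval.toNNReal a : ℝ≥0∞) := fun a => by
    rw [← unitInterval.coe_toNNReal, ENNReal.ofReal_coe_nnreal]
  rw [bernoulliMeasure_def, lintegral_add_measure, lintegral_smul_measure, lintegral_smul_measure,
    lintegral_dirac, lintegral_dirac, h, ← unitInterval.coe_symm_eq, h]
  rfl

open Classical in
/-- Power received at `a` from a packet at `x` with mark `t`. -/
noncomputable def markedPower (a : Plane) (L α : ℝ) (x : Plane × ℝ) (t : Bool × Bool × ℝ) :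
    ℝ≥0∞ :=
  if x.2 ∈ Set.Ioc (-L) 0 ∧ t.1 = true ∧ t.2.1 = true then
    ENNReal.ofReal (dist a x.1 ^ (-α) * t.2.2 ^ 2)
  else 0

theorem measurable_markedPower (a : Plane) (L α : ℝ) :
    Measurable (Function.uncurry (markedPower a L α)) := by
  unfold markedPower
  refine Measurable.ite ?_ (by fun_prop) measurable_const
  refine (measurableSet_Ioc.preimage (f := fun z : (Plane × ℝ) × (Bool × Bool × ℝ) => z.1.2)
    (by fun_prop)).inter (MeasurableSet.inter ?_ ?_)
  · exact (measurableSet_singleton true).preimage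
      (f := fun z : (Plane × ℝ) × (Bool × Bool × ℝ) => z.2.1) (by fun_prop)
  · exact (measurableSet_singleton true).preimage
      (f := fun z : (Plane × ℝ) × (Bool × Bool × ℝ) => z.2.2.1) (by fun_prop)

/-- The law of the mark of a packet. -/
noncomputable def markLaw (b r : unitInterval) (s : ℝ) : Measure (Bool × Bool × ℝ) :=
  (bernoulliMeasure true false (unitInterval.symm b)).prod
    ((bernoulliMeasure true false r).prod (rayleigh s))

theorem isProbabilityMeasure_markLaw (b r : unitInterval) {s : ℝ} (hs : 0 < s) :
    IsProbabilityMeasure (markLaw b r s) := by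
  have := isProbabilityMeasure_rayleigh hs
  unfold markLaw
  infer_instance

/-- Thinning: a packet on air interferes with probability `(1 - b) * r`, and then the Laplace
transform of the Rayleigh power applies. In all other cases its factor is `1`, which cancels. -/
theorem one_sub_lintegral_expNeg_markedPower (b r : unitInterval) {s c : ℝ} (hs : 0 < s)
    (hc : 0 ≤ c) (a : Plane) (L α : ℝ) (x : Plane × ℝ) :
    1 - ∫⁻ t, expNeg (ENNReal.ofReal c * markedPower a L α x t) ∂markLaw b r s
      = ENNReal.ofReal ((1 - b) * r) *
          ENNReal.ofReal (1 - 1 / (1 + 2 * s ^ 2 * c * dist a x.1 ^ (-α))) *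
        (Set.Ioc (-L) 0).indicator 1 x.2 := by
  have := isProbabilityMeasure_rayleigh hs
  have hm : Measurable fun t => expNeg (ENNReal.ofReal c * markedPower a L α x t) :=
    measurable_expNeg.comp
      (((measurable_markedPower a L α).comp measurable_prodMk_left).const_mul _)
  by_cases hx : x.2 ∈ Set.Ioc (-L) 0
  · have hb := b.2.1
    have hb' := b.2.2
    have hr := r.2.1
    have hr' := r.2.2
    have hg : 0 ≤ dist a x.1 ^ (-α) := by positivity
    set v : ℝ := 1 / (1 + 2 * s ^ 2 * c * dist a x.1 ^ (-α)) with hv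
    have hv0 : 0 ≤ v := by positivity
    have hv1 : v ≤ 1 := by
      rw [hv, div_le_one (by positivity)]
      have : 0 ≤ 2 * s ^ 2 * c * dist a x.1 ^ (-α) := by positivity
      linarith
    have htt : ∫⁻ f, expNeg (ENNReal.ofReal c * markedPower a L α x (true, true, f)) ∂rayleigh s
        = ENNReal.ofReal v := by
      simp only [markedPower, hx, and_self, if_true, ← ENNReal.ofReal_mul hc,
        ← mul_assoc]
      rw [lintegral_expNeg_rayleigh hs (by positivity), hv, ← mul_assoc]
    have htf : ∫⁻ f, expNeg (ENNReal.ofReal c * markedPower a L α x (true, false, f)) ∂rayleigh s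
        = 1 := by
      simp [markedPower]
    have hf : ∀ e, ∫⁻ f, expNeg (ENNReal.ofReal c * markedPower a L α x (false, e, f)) ∂rayleigh s
        = 1 := by
      simp [markedPower]
    have hme : ∀ e, Measurable fun y => expNeg (ENNReal.ofReal c * markedPower a L α x (e, y)) :=
      fun e => hm.comp measurable_prodMk_left
    have hint : ∫⁻ t, expNeg (ENNReal.ofReal c * markedPower a L α x t) ∂markLaw b r s
        = ENNReal.ofReal ((1 - b) * (r * v + (1 - r)) + b * (r + (1 - r))) := by
      rw [markLaw, lintegral_prod _ hm.aemeasurable, lintegral_bernoulliMeasure,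
        lintegral_prod _ (hme true).aemeasurable, lintegral_prod _ (hme false).aemeasurable,
        lintegral_bernoulliMeasure, lintegral_bernoulliMeasure, htt, htf, hf, hf,
        unitInterval.coe_symm_eq, mul_one, mul_one, sub_sub_cancel,
        ← ENNReal.ofReal_mul hr, ← ENNReal.ofReal_add (by positivity) (by linarith),
        ← ENNReal.ofReal_mul (by linarith), ← ENNReal.ofReal_add (by positivity) (by linarith),
        ← ENNReal.ofReal_mul hb, ← ENNReal.ofReal_add]
      · exact mul_nonneg (by linarith) (add_nonneg (by positivity) (by linarith))
      · exact mul_nonneg hb (by linarith)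
    rw [hint, Set.indicator_of_mem hx, Pi.one_apply, mul_one,
      ← ENNReal.ofReal_mul (mul_nonneg (by linarith) hr), ← ENNReal.ofReal_one,
      ← ENNReal.ofReal_sub]
    · congr 1
      ring
    · exact add_nonneg (mul_nonneg (by linarith) (add_nonneg (by positivity) (by linarith)))
        (mul_nonneg hb (by linarith))
  · have := isProbabilityMeasure_markLaw b r hs
    simp [markedPower, hx]

namespace Network.HasIndependentBackoffs

variable {Ω : Type*} [MeasurableSpace Ω] {P : Measure Ω} {lam L d s α θ : ℝ} {b r : unitInterval}
  {N : Network Ω}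

theorem measurable_receivedPower (h : N.HasIndependentBackoffs P lam L d s b r) (m : ℕ) :
    Measurable (N.receivedPower L α m) :=
  (measurable_markedPower N.rx L α).comp ((h.packets.measurable m).prodMk
    ((h.measurable_clear m).prodMk ((h.measurable_charged m).prodMk (h.measurable_fade m))))

theorem measurable_SIR (h : N.HasIndependentBackoffs P lam L d s b r) :
    Measurable (N.SIR L α) := by
  have := h.measurable_fade₀
  exact Measurable.div (by fun_prop) (Measurable.tsum fun m => h.measurable_receivedPower m)

/-- Conditioning on the interference power. -/
theorem measure_lt_SIR_eq_lintegral [IsProbabilityMeasure P] (hd : 0 < d) (hs : 0 < s)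
    (hθ : 0 < θ) (h : N.HasIndependentBackoffs P lam L d s b r) :
    P {ω | ENNReal.ofReal θ < N.SIR L α ω}
      = ∫⁻ ω, expNeg (ENNReal.ofReal (θ / (2 * s ^ 2 * d ^ (-α))) *
          ∑' m, N.receivedPower L α m ω) ∂P := by
  have := isProbabilityMeasure_rayleigh hs
  set Z : Ω → (ℕ → Plane × ℝ) × (ℕ → Bool × Bool × ℝ) := fun ω =>
    ((fun m => N.packet m ω), fun m => (N.clear m ω, N.charged m ω, N.fade m ω)) with hZ
  have hZm : Measurable Z :=
    (measurable_pi_lambda _ h.packets.measurable).prodMk (measurable_pi_lambda _ fun m =>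
      (h.measurable_clear m).prodMk ((h.measurable_charged m).prodMk (h.measurable_fade m)))
  set J : (ℕ → Plane × ℝ) × (ℕ → Bool × Bool × ℝ) → ℝ≥0∞ := fun z =>
    ∑' m, markedPower N.rx L α (z.1 m) (z.2 m) with hJ
  have hJm : Measurable J := Measurable.tsum fun m =>
    (measurable_markedPower N.rx L α).comp (f := fun z :
      (ℕ → Plane × ℝ) × (ℕ → Bool × Bool × ℝ) => (z.1 m, z.2 m))
      (((measurable_pi_apply m).comp measurable_fst).prodMk
        ((measurable_pi_apply m).comp measurable_snd))
  set A : Set (ℝ × ((ℕ → Plane × ℝ) × (ℕ → Bool × Bool × ℝ))) :=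
    {y | ENNReal.ofReal θ < ENNReal.ofReal (d ^ (-α) * y.1 ^ 2) / J y.2} with hA
  have hAm : MeasurableSet A := measurableSet_lt measurable_const
    (Measurable.div (by fun_prop) (hJm.comp measurable_snd))
  -- The success event depends only on the typical fading and on the packets with their marks, which
  -- are independent, so the fading can be integrated first.
  have hset : {ω | ENNReal.ofReal θ < N.SIR L α ω} = (fun ω => (N.fade₀ ω, Z ω)) ⁻¹' A := by
    ext ω
    simp only [SIR, h.dist_pair]
    rfl
  have hlaw := (indepFun_iff_map_prod_eq_prod_map_map h.measurable_fade₀.aemeasurable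
    hZm.aemeasurable).1 h.indep_fade₀
  have := Measure.isProbabilityMeasure_map (μ := P) hZm.aemeasurable
  rw [hset, ← Measure.map_apply (h.measurable_fade₀.prodMk hZm) hAm, hlaw, h.fade₀_law.map_eq,
    Measure.prod_apply_symm hAm, lintegral_map (measurable_measure_prodMk_right hAm) hZm]
  exact lintegral_congr fun ω =>
    rayleigh_ofReal_lt_div hs hθ (Real.rpow_pos_of_pos hd _) (J (Z ω))

/-- Success probability of the typical link. -/
theorem measure_lt_SIR [IsProbabilityMeasure P] (hlam : 0 < lam) (hL : 0 < L) (hd : 0 < d)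
    (hs : 0 < s) (hα : 2 < α) (hθ : 0 < θ) (h : N.HasIndependentBackoffs P lam L d s b r) :
    P {ω | ENNReal.ofReal θ < N.SIR L α ω}
      = ENNReal.ofReal (Real.exp (-(lam * ((1 - b) * r) / lamMax d θ α))) := by
  have := isProbabilityMeasure_markLaw b r hs
  have hκ := kappa_pos hα
  have hdα : 0 < d ^ (-α) := Real.rpow_pos_of_pos hd _
  have hqr : 0 ≤ (1 - (b : ℝ)) * r := mul_nonneg (sub_nonneg.2 b.2.2) r.2.1
  set c : ℝ := θ / (2 * s ^ 2 * d ^ (-α)) with hc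
  have hc0 : 0 < c := by positivity
  rw [h.measure_lt_SIR_eq_lintegral hd hs hθ, ← hc]
  simp_rw [← ENNReal.tsum_mul_left]
  have hσ : SigmaFinite (ENNReal.ofReal (lam / L) • (volume : Measure (Plane × ℝ))) := by
    change SigmaFinite (Real.toNNReal (lam / L) • (volume : Measure (Plane × ℝ)))
    infer_instance
  have hmk := h.packets.lintegral_expNeg_marked
    (M := fun m ω => (N.clear m ω, N.charged m ω, N.fade m ω)) (ν := markLaw b r s)
    (h := fun x t => ENNReal.ofReal c * markedPower N.rx L α x t)
    (fun m => (h.measurable_clear m).prodMk ((h.measurable_charged m).prodMk (h.measurable_fade m)))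
    h.mark_law h.indep_marks h.indep_packets ((measurable_markedPower N.rx L α).const_mul _)
  refine hmk.trans ?_
  simp_rw [one_sub_lintegral_expNeg_markedPower b r hs hc0.le]
  -- The Rayleigh scale cancels: it multiplies signal and interference alike.
  have hK : 2 * s ^ 2 * c = θ * d ^ α := by
    rw [hc, Real.rpow_neg hd.le]
    field_simp
  have hKp : 0 < θ * d ^ α := by positivity
  -- The integral splits into plane and time; the arrival window has length `L`, which cancels the
  -- `L` in `lam / L`.
  rw [hK, lintegral_smul_measure, Measure.volume_eq_prod,
    lintegral_prod_mul (f := fun x : Plane => ENNReal.ofReal ((1 - b) * r) *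
      ENNReal.ofReal (1 - 1 / (1 + θ * d ^ α * dist N.rx x ^ (-α))))
      (g := (Set.Ioc (-L) 0).indicator 1) (by fun_prop)
      (measurable_one.indicator measurableSet_Ioc).aemeasurable,
    lintegral_const_mul _ (by fun_prop), lintegral_plane_one_sub hα hKp,
    lintegral_indicator_one measurableSet_Ioc, Real.volume_Ioc, zero_sub, neg_neg, smul_eq_mul,
    ← ENNReal.ofReal_mul hqr, ← ENNReal.ofReal_mul (by positivity),
    ← ENNReal.ofReal_mul (by positivity), expNeg_ofReal (by positivity)]
  congr 3
  rw [lamMax, Real.mul_rpow hθ.le (by positivity), ← Real.rpow_mul hd.le,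
    mul_div_cancel₀ _ (by linarith), Real.rpow_two]
  field_simp

end Network.HasIndependentBackoffs

/-- The fixed-point equation of the back-off probability. -/
theorem Network.IsBackoffProbability.one_sub_eq {Ω : Type*} [MeasurableSpace Ω] {P : Measure Ω}
    [IsProbabilityMeasure P] {lam L d s α θ p : ℝ} {e₀ : ℕ} {N : Network Ω} {b : unitInterval}
    (hlam : 0 < lam) (hL : 0 < L) (hd : 0 < d) (hs : 0 < s) (hα : 2 < α) (hθ : 0 < θ)
    (hp₀ : 0 ≤ p) (hp₁ : p ≤ 1) (hb : N.IsBackoffProbability P lam L d s α θ p e₀ b) :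
    1 - (b : ℝ) = Real.exp (-(lam * min p (1 - b) / lamMax d θ α)) := by
  obtain ⟨r, hr, h, hPb⟩ := hb
  have hm : MeasurableSet {ω | ENNReal.ofReal θ < N.SIR L α ω} :=
    measurableSet_lt measurable_const h.measurable_SIR
  have hc : P.real {ω | ENNReal.ofReal θ < N.SIR L α ω}ᶜ = b := hPb
  rw [probReal_compl_eq_one_sub hm, measureReal_def, h.measure_lt_SIR hlam hL hd hs hα hθ,
    ENNReal.toReal_ofReal (Real.exp_nonneg _)] at hc
  rw [← hr.mul_eq_min hp₀ hp₁ (sub_nonneg.2 b.2.2) (by linarith [b.2.1])]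
  linarith

/-! ### Lambert's function -/

theorem injOn_mul_exp : Set.InjOn (fun w : ℝ => w * Real.exp w) (Set.Ici (-1)) := by
  refine StrictMonoOn.injOn (strictMonoOn_of_deriv_pos (convex_Ici _) (by fun_prop) fun w hw => ?_)
  rw [interior_Ici] at hw
  have hw' : -1 < w := hw
  have h1 : HasDerivAt (fun w : ℝ => w * Real.exp w) (1 * Real.exp w + w * Real.exp w) w :=
    (hasDerivAt_id w).mul (Real.hasDerivAt_exp w)
  rw [h1.deriv, ← add_mul]
  exact mul_pos (by linarith) (Real.exp_pos w)

/-- The intermediate value theorem on `[0, y]` suffices, since `y ≤ y * exp y`. -/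
theorem exists_mul_exp_eq {y : ℝ} (hy : 0 ≤ y) :
    ∃ w ∈ Set.Ici (-1 : ℝ), w * Real.exp w = y := by
  obtain ⟨w, hw, h⟩ := intermediate_value_Icc hy
    (f := fun w : ℝ => w * Real.exp w) (by fun_prop)
    (show y ∈ Set.Icc _ _ from ⟨by simpa using hy,
      le_mul_of_one_le_right hy (Real.one_le_exp hy)⟩)
  exact ⟨w, le_trans (by norm_num) hw.1, h⟩

theorem lambertW₀_mul_exp {y : ℝ} (hy : 0 ≤ y) :
    lambertW₀ y * Real.exp (lambertW₀ y) = y :=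
  Function.invFunOn_eq (exists_mul_exp_eq hy)

theorem eq_lambertW₀ {w y : ℝ} (hw : -1 ≤ w) (hy : 0 ≤ y) (h : w * Real.exp w = y) :
    w = lambertW₀ y :=
  injOn_mul_exp hw (Function.invFunOn_mem (exists_mul_exp_eq hy))
    (h.trans (lambertW₀_mul_exp hy).symm)

/-- The equation `x = 1 - exp (-ρ (1 - x))` solved by Lambert's function. -/
theorem eq_one_sub_exp_iff {ρ : ℝ} (hρ : 0 < ρ) (x : ℝ) :
    x = 1 - Real.exp (-(ρ * (1 - x))) ↔ x = 1 - lambertW₀ ρ / ρ := by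
  constructor
  · intro h
    have h1 : 1 - x = Real.exp (-(ρ * (1 - x))) := by linarith
    have h2 : 0 < 1 - x := h1 ▸ Real.exp_pos _
    -- Lambert's equation for `w = ρ * (1 - x)`. Any real solution has `1 - x` equal to an
    -- exponential, so `w > 0` and only the principal branch can occur.
    have h3 : ρ * (1 - x) * Real.exp (ρ * (1 - x)) = ρ := by
      nth_rewrite 1 [h1]
      rw [mul_assoc, ← Real.exp_add, neg_add_cancel, Real.exp_zero, mul_one]
    have h4 := eq_lambertW₀ (by linarith [mul_pos hρ h2]) hρ.le h3
    rw [← h4]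
    field_simp
    ring
  · intro h
    have h1 : ρ * (1 - x) = lambertW₀ ρ := by
      rw [h]; field_simp; ring
    have h2 := lambertW₀_mul_exp hρ.le
    rw [h1, Real.exp_neg, h, sub_right_inj, div_eq_iff hρ.ne', eq_inv_mul_iff_mul_eq₀
      (Real.exp_ne_zero _), mul_comm, h2]

end EnergyCSMA

/-! ### Selecting the regime in the fixed-point equation -/

theorem theorem5 {Ω : Type*} [MeasurableSpace Ω] (P : MeasureTheory.Measure Ω)
    [MeasureTheory.IsProbabilityMeasure P]
    (lam L d s α θ p : ℝ) (hlam : 0 < lam) (hL : 0 < L) (hd : 0 < d) (hs : 0 < s)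
    (hα : 2 < α) (hθ : 0 < θ) (hp₀ : 0 < p) (hp₁ : p ≤ 1) (e₀ : ℕ)
    (N : EnergyCSMA.Network Ω) (b : unitInterval)
    (hb : N.IsBackoffProbability P lam L d s α θ p e₀ b) :
    (p < -EnergyCSMA.lamMax d θ α * Real.log p / lam →
      (b : ℝ) = 1 - Real.exp (-(p * lam / EnergyCSMA.lamMax d θ α))) ∧
    (¬ p < -EnergyCSMA.lamMax d θ α * Real.log p / lam →
      (b : ℝ) = 1 - Real.exp (-(lam * (1 - b) / EnergyCSMA.lamMax d θ α)) ∧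
      ∀ x : ℝ, x = 1 - Real.exp (-(lam * (1 - x) / EnergyCSMA.lamMax d θ α)) ↔
        x = 1 - EnergyCSMA.lamMax d θ α / lam *
          EnergyCSMA.lambertW₀ (lam / EnergyCSMA.lamMax d θ α)) := by
  have hfix := hb.one_sub_eq hlam hL hd hs hα hθ hp₀.le hp₁
  have hM : 0 < EnergyCSMA.lamMax d θ α := by
    have := EnergyCSMA.kappa_pos hα
    unfold EnergyCSMA.lamMax
    positivity
  set M := EnergyCSMA.lamMax d θ α
  -- In this form the case condition compares `p` with the success probability that would result if
  -- energy were the bottleneck. In each case monotonicity of the exponential or the equation itself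
  -- excludes the wrong argument of `min p (1 - b)`.
  have hcond : p < -M * Real.log p / lam ↔ p < Real.exp (-(lam * p / M)) := by
    rw [← Real.log_lt_iff_lt_exp hp₀, lt_div_iff₀ hlam, lt_neg, div_lt_iff₀ hM]
    constructor <;> intro h <;> linarith
  rw [hcond]
  refine ⟨fun h => ?_, fun h => ⟨?_, fun x => ?_⟩⟩
  · rcases le_total p (1 - b) with hpb | hpb
    · rw [min_eq_left hpb] at hfix
      rw [mul_comm p, ← hfix]; ring
    · rw [min_eq_right hpb] at hfix
      have : Real.exp (-(lam * p / M)) ≤ Real.exp (-(lam * (1 - b) / M)) :=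
        Real.exp_le_exp.2 (by gcongr)
      linarith
  · rcases lt_or_ge p (1 - b) with hpb | hpb
    · rw [min_eq_left hpb.le] at hfix
      exact absurd (hpb.trans_eq hfix) h
    · rw [min_eq_right hpb] at hfix
      linarith
  · rw [mul_div_right_comm, EnergyCSMA.eq_one_sub_exp_iff (div_pos hlam hM), div_div_eq_mul_div,
      mul_comm, mul_div_right_comm]
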